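/- Let $d\ge 2$. Consider site percolation on $\mathbb{Z}^d$ with parameter $p\in[0,1]$: under $\mathbb{P}_p$ each site is open with probability $p$, independently of all other sites. Let $p_c=p_c(d)=\sup\{p\in[0,1]:\mathbb{P}_p(\text{the open cluster of }0\text{ is infinite})=0\}$ be the critical probability, where sites are neighbours when their $\ell^1$-distance is $1$. For $x\in\mathbb{Z}^d$ put $\|x\|=\max_{1\le i\le d}|x_i|$, let $\Lambda(r)=[-r,r]^d$, and let $\{0\leftrightarrow x\text{ in }\Lambda(r)\}$ be the event that there is an open path from $0$ to $x$ (a nearest-neighbour path all of whose sites, including its endpoints, are open) which lies in $\Lambda(r)$. There is a constant $c>0$, depending only on $d$, such that $$\mathbb{P}_{p_c}\bigl(0\leftrightarrow x\text{ in }\Lambda(4\|x\|)\bigr)\ \ge\ \frac{c}{\|x\|^{d^2}}\qquad\text{for all }x\in\mathbb{Z}^d,\ x\ne 0,$$ and, equivalently, $$\mathbb{P}_{p_c}\bigl(0\leftrightarrow x\text{ in }\Lambda(4n)\bigr)\ \ge\ \frac{c}{n^{d^2}}\qquad\text{for all integers }n\ge 1\text{ and all }x\in\Lambda(n)\cap\mathbb{Z}^d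 .$$ -/

import Mathlib

open MeasureTheory ProbabilityTheory

namespace SitePercolation

/-- The sites of the lattice `ℤ^d`. -/
abbrev Site (d : ℕ) : Type := Fin d → ℤ

/-- A configuration of site percolation: `ω x = true` means that the site `x` is open. -/
abbrev Config (d : ℕ) : Type := Site d → Bool

/-- The law `P_p` of site percolation on `ℤ^d`: sites are open independently of each other,
each with probability `p`. -/
noncomputable def perc (d : ℕ) (p : unitInterval) : Measure (Config d) :=
  Measure.infinitePi fun _ : Site d => bernoulliMeasure true false p

/-- The `ℓ¹`-distance on `ℤ^d`; two sites are neighbours when it equals `1`. -/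
def dist1 {d : ℕ} (x y : Site d) : ℤ := ∑ i, |x i - y i|

/-- The lattice points of the box `Λ(r) = [-r, r]^d`. -/
def box (d : ℕ) (r : ℝ) : Set (Site d) := {x | ∀ i, |(x i : ℝ)| ≤ r}

/-- In the configuration `ω` there is an open path from `x` to `y` which lies in `S`: a sequence
`γ 0 = x, …, γ k = y` of open sites of `S` in which consecutive sites are neighbours or equal.
All sites of the path, including both endpoints, are open. -/
def ConnectedIn {d : ℕ} (ω : Config d) (S : Set (Site d)) (x y : Site d) : Prop :=
  ∃ (k : ℕ) (γ : ℕ → Site d), γ 0 = x ∧ γ k = y ∧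
    (∀ i < k, dist1 (γ (i + 1)) (γ i) ≤ 1) ∧ ∀ i ≤ k, γ i ∈ S ∧ ω (γ i) = true

/-- The event `{x ↔ y in S}`. -/
def connEvent {d : ℕ} (S : Set (Site d)) (x y : Site d) : Set (Config d) :=
  {ω | ConnectedIn ω S x y}

/-- The open cluster of the site `x` in the configuration `ω`. -/
def cluster {d : ℕ} (ω : Config d) (x : Site d) : Set (Site d) :=
  {y | ConnectedIn ω Set.univ x y}

/-- The percolation probability `θ(p)`: the probability that the open cluster of the origin is
infinite. -/
noncomputable def theta (d : ℕ) (p : unitInterval) : ℝ :=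
  (perc d p).real {ω | (cluster ω 0).Infinite}

/-- The critical probability `p_c(d) = sup {p ∈ [0, 1] : θ(p) = 0}`. -/
noncomputable def criticalProb (d : ℕ) : unitInterval :=
  sSup {p | theta d p = 0}

end SitePercolation

/-! At criticality, every finite set containing the origin has expected number of exits at least one
(`one_le_sum_exitEvent`): otherwise exploring the cluster inside the set gives θ ≤ qθ with q < 1,
and since q is continuous in the parameter this persists above the critical point.

Call a site of [-n, n]^d good if it is connected to the origin inside the box with probability at
least δ, where δ is of order n^{-d}. If the good cluster of the origin missed the boundary of the
box, each of the at most (3n)^d sites next to it would be bad, and the expected number of exits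
would be at most 1/2. Hence a path of good sites reaches the boundary (`exists_path_connEvent_ge`).

A topological argument (`exists_signed_sum`, through the Poincaré–Miranda theorem
`discrete_miranda`) writes any x in the box, up to an error at most d per coordinate, as a sum of d
points of this path, each transformed by a symmetry of the lattice. By invariance and Harris'
inequality the d connections can be chained at cost δ^d, of order n^{-d²}, and the error is bridged
at constant cost. Partial sums stay in [-3n, 3n]^d, so all connections stay in the box of radius 4n.
-/

namespace SitePercolation

/-! ### Discrete Poincaré–Miranda theorem by mod 2 cohomology of the grid. -/

section DiscreteMiranda

variable {ι : Type*} [DecidableEq ι]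

/-- The mod 2 cup product `δb₁ ∪ ⋯ ∪ δbₘ` of the coboundaries of the functions in the list,
evaluated on the cube with base vertex `v` spanned by the directions in `A`. -/
def cupSum : List ((ι → ℕ) → ZMod 2) → Finset ι → (ι → ℕ) → ZMod 2
  | [], A, _ => if A = ∅ then 1 else 0
  | b :: L, A, v => ∑ j ∈ A, (b (v + Pi.single j 1) - b v) *
      cupSum L (A.erase j) (v + Pi.single j 1)

lemma sum_erase_symm_eq_zero (A : Finset ι) (X : ι → ι → ZMod 2)
    (hX : ∀ j k, X j k = X k j) : ∑ j ∈ A, ∑ k ∈ A.erase j, X j k = 0 := by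
  rw [Finset.sum_sigma']
  refine Finset.sum_involution (fun a _ => ⟨a.2, a.1⟩) ?_ ?_ ?_ ?_
  · rintro ⟨j, k⟩ _
    simp only
    rw [hX k j]
    exact CharTwo.add_self_eq_zero _
  · rintro ⟨j, k⟩ h _ h'
    simp only [Finset.mem_sigma, Finset.mem_erase] at h
    exact h.2.1 (congrArg Sigma.fst h')
  · rintro ⟨j, k⟩ h
    simp only [Finset.mem_sigma, Finset.mem_erase] at h ⊢
    exact ⟨h.2.2, h.2.1.symm, h.1⟩
  · rintro ⟨j, k⟩ _
    rfl

/-- A cup product of coboundaries is a cocycle. The Leibniz rule for differences leaves a second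
difference of `b`, symmetric in the two directions and so zero mod 2, plus the coboundary of the
shorter product, zero by induction. -/
lemma cupSum_closed (L : List ((ι → ℕ) → ZMod 2)) : ∀ (A : Finset ι) (v : ι → ℕ),
    ∑ j ∈ A, (cupSum L (A.erase j) (v + Pi.single j 1) - cupSum L (A.erase j) v) = 0 := by
  induction L with
  | nil => intro A v; simp [cupSum]
  | cons b L ih =>
    intro A v
    have key : ∀ j ∈ A, cupSum (b :: L) (A.erase j) (v + Pi.single j 1)
          - cupSum (b :: L) (A.erase j) v
        = ∑ k ∈ A.erase j, (b (v + Pi.single j 1 + Pi.single k 1) - b (v + Pi.single j 1)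
            - (b (v + Pi.single k 1) - b v)) *
            cupSum L ((A.erase j).erase k) (v + Pi.single j 1 + Pi.single k 1)
          + ∑ k ∈ A.erase j, (b (v + Pi.single k 1) - b v) *
            (cupSum L ((A.erase k).erase j) (v + Pi.single k 1 + Pi.single j 1)
              - cupSum L ((A.erase k).erase j) (v + Pi.single k 1)) := by
      intro j _
      simp only [cupSum]
      rw [← Finset.sum_sub_distrib, ← Finset.sum_add_distrib]
      refine Finset.sum_congr rfl fun k _ => ?_
      rw [Finset.erase_right_comm (a := k) (b := j),
        add_right_comm v (Pi.single k 1) (Pi.single j 1)]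
      ring
    rw [Finset.sum_congr rfl key, Finset.sum_add_distrib, sum_erase_symm_eq_zero, zero_add]
    · rw [Finset.sum_comm' (t' := A) (s' := fun k => A.erase k)]
      · refine Finset.sum_eq_zero fun k _ => ?_
        rw [← Finset.mul_sum, ih, mul_zero]
      · intro j k
        simp only [Finset.mem_erase]
        tauto
    · intro j k
      rw [Finset.erase_right_comm (a := k) (b := j),
        add_right_comm v (Pi.single k 1) (Pi.single j 1)]
      ring

/-- On a cube lying in the face, the coboundary of `b` vanishes along every edge, so each product
has a zero factor. This kills the side faces in `sum_cupSum_eq_one`. -/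
lemma cupSum_eq_zero_of_const {j : ι} {c : ℕ} {β : ZMod 2} {b : (ι → ℕ) → ZMod 2}
    (hb : ∀ u, u j = c → b u = β) (L : List ((ι → ℕ) → ZMod 2)) :
    b ∈ L → ∀ (A : Finset ι) (v : ι → ℕ), j ∉ A → v j = c → cupSum L A v = 0 := by
  induction L with
  | nil => simp
  | cons b' L ih =>
    intro hmem A v hj hv
    refine Finset.sum_eq_zero fun k hk => ?_
    have hkj : (v + Pi.single k 1 : ι → ℕ) j = c := by
      have : j ≠ k := fun h => hj (h ▸ hk)
      simp [Pi.single_eq_of_ne this, hv]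
    rcases List.mem_cons.1 hmem with rfl | h
    · rw [hb _ hkj, hb _ hv, sub_self, zero_mul]
    · rw [ih h _ _ (fun h => hj (Finset.mem_of_mem_erase h)) hkj, mul_zero]

lemma exists_change_of_cupSum_ne_zero (L : List ((ι → ℕ) → ZMod 2)) :
    ∀ (A : Finset ι) (v : ι → ℕ), cupSum L A v ≠ 0 → ∀ b ∈ L, ∃ u u' : ι → ℕ,
      b u ≠ b u' ∧ (∀ i, v i ≤ u i ∧ u i ≤ v i + if i ∈ A then 1 else 0) ∧
      (∀ i, v i ≤ u' i ∧ u' i ≤ v i + if i ∈ A then 1 else 0) := by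
  induction L with
  | nil => simp
  | cons b L ih =>
    intro A v hne b' hb'
    obtain ⟨j, hj, hjne⟩ := Finset.exists_ne_zero_of_sum_ne_zero hne
    rcases List.mem_cons.1 hb' with rfl | h
    · refine ⟨v + Pi.single j 1, v, sub_ne_zero.1 (left_ne_zero_of_mul hjne), fun i => ?_,
        fun i => ⟨le_rfl, by simp⟩⟩
      by_cases h : i = j
      · subst h; simp [hj]
      · simp [Pi.single_eq_of_ne h]
    · obtain ⟨u, u', h1, h2, h3⟩ := ih _ _ (right_ne_zero_of_mul hjne) b' h
      have key : ∀ w : ι → ℕ, (∀ i, (v + Pi.single j 1 : ι → ℕ) i ≤ w i ∧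
          w i ≤ (v + Pi.single j 1 : ι → ℕ) i + if i ∈ A.erase j then 1 else 0) →
          ∀ i, v i ≤ w i ∧ w i ≤ v i + if i ∈ A then 1 else 0 := by
        intro w hw i
        have := hw i
        by_cases h : i = j
        · subst h
          simp [hj] at this ⊢
          omega
        · simp [h] at this ⊢
          exact this
      exact ⟨u, u', h1, key u h2, key u' h3⟩

variable [Fintype ι]

lemma sum_piFinset_shift (s : ι → Finset ℕ) (j : ι) (a : ℕ) (f : (ι → ℕ) → ZMod 2) :
    ∑ v ∈ Fintype.piFinset (Function.update s j {a}), f (v + Pi.single j 1)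
      = ∑ v ∈ Fintype.piFinset (Function.update s j {a + 1}), f v := by
  refine Finset.sum_bij' (fun v _ => v + Pi.single j 1) (fun v _ => v - Pi.single j 1)
    ?_ ?_ ?_ ?_ ?_
  · intro v hv
    rw [Fintype.mem_piFinset] at hv ⊢
    intro i
    have := hv i
    by_cases h : i = j
    · subst h; simp at this ⊢; exact this
    · simpa [Function.update_of_ne h, Pi.single_eq_of_ne h] using this
  · intro v hv
    rw [Fintype.mem_piFinset] at hv ⊢
    intro i
    have := hv i
    by_cases h : i = j
    · subst h; simp at this ⊢; omega
    · simpa [Function.update_of_ne h, Pi.single_eq_of_ne h] using this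
  · intro v _; simp
  · intro v hv
    rw [Fintype.mem_piFinset] at hv
    ext i
    have := hv i
    by_cases h : i = j
    · subst h; simp at this ⊢; omega
    · simp [Pi.single_eq_of_ne h]
  · intro v _; rfl

lemma sum_piFinset_slices (s : ι → Finset ℕ) (j : ι) (f : (ι → ℕ) → ZMod 2) :
    ∑ v ∈ Fintype.piFinset s, f v
      = ∑ a ∈ s j, ∑ v ∈ Fintype.piFinset (Function.update s j {a}), f v := by
  rw [← Finset.sum_fiberwise_of_maps_to (g := fun v => v j) (t := s j)
    (fun v hv => Fintype.mem_piFinset.1 hv j)]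
  refine Finset.sum_congr rfl fun a ha => Finset.sum_congr ?_ fun _ _ => rfl
  ext v
  simp only [Finset.mem_filter, Fintype.mem_piFinset]
  constructor
  · rintro ⟨h1, h2⟩ i
    by_cases h : i = j
    · subst h; simp [h2]
    · simpa [Function.update_of_ne h] using h1 i
  · intro h
    have hj : v j = a := by simpa using h j
    refine ⟨fun i => ?_, hj⟩
    by_cases hi : i = j
    · subst hi; rw [hj]; exact ha
    · simpa [Function.update_of_ne hi] using h i

lemma sum_piFinset_telescope (s : ι → Finset ℕ) (j : ι) (N : ℕ) (hs : s j = Finset.range N)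
    (f : (ι → ℕ) → ZMod 2) :
    ∑ v ∈ Fintype.piFinset s, (f (v + Pi.single j 1) - f v)
      = ∑ v ∈ Fintype.piFinset (Function.update s j {N}), f v
        - ∑ v ∈ Fintype.piFinset (Function.update s j {0}), f v := by
  rw [sum_piFinset_slices s j, hs]
  simp only [Finset.sum_sub_distrib, sum_piFinset_shift]
  rw [← Finset.sum_sub_distrib,
    Finset.sum_range_sub (fun a => ∑ v ∈ Fintype.piFinset (Function.update s j {a}), f v)]

/-- Stokes' theorem: as the remaining product is closed, prefixing the coboundary of `b i` gives the
coboundary of `b i` times that product, so the sum over the grid telescopes to the boundary. Faces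
in other directions contribute zero, the face at 0 is killed by `b i = 0`, and the face at `N` is
the same sum in one dimension less. `w` records the frozen coordinates. -/
lemma sum_cupSum_eq_one (N : ℕ) (b : ι → (ι → ℕ) → ZMod 2)
    (h0 : ∀ i v, v i = 0 → b i v = 0) (hN : ∀ i v, v i = N → b i v = 1) (l : List ι) :
    l.Nodup → ∀ w : ι → ℕ,
    ∑ v ∈ Fintype.piFinset (fun i => if i ∈ l.toFinset then Finset.range N else {w i}),
      cupSum (l.map b) l.toFinset v = 1 := by
  induction l with
  | nil => intro _ w; simp [cupSum, Fintype.piFinset_singleton]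
  | cons i l ih =>
    intro hnd w
    obtain ⟨hil, hl⟩ := List.nodup_cons.1 hnd
    set A := (i :: l).toFinset with hA
    have hAi : A.erase i = l.toFinset := by
      rw [hA, List.toFinset_cons, Finset.erase_insert (by simpa using hil)]
    set s : ι → Finset ℕ := fun k => if k ∈ A then Finset.range N else {w k} with hs
    have hexp : ∀ v, cupSum ((i :: l).map b) A v
        = ∑ j ∈ A, (b i (v + Pi.single j 1) * cupSum (l.map b) (A.erase j) (v + Pi.single j 1)
            - b i v * cupSum (l.map b) (A.erase j) v) := by
      intro v
      have hc := cupSum_closed (l.map b) A v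
      have : ∑ j ∈ A, (b i (v + Pi.single j 1) *
            cupSum (l.map b) (A.erase j) (v + Pi.single j 1)
            - b i v * cupSum (l.map b) (A.erase j) v)
          = cupSum ((i :: l).map b) A v + b i v * ∑ j ∈ A,
            (cupSum (l.map b) (A.erase j) (v + Pi.single j 1)
              - cupSum (l.map b) (A.erase j) v) := by
        simp only [List.map_cons, cupSum]
        rw [Finset.mul_sum, ← Finset.sum_add_distrib]
        exact Finset.sum_congr rfl fun _ _ => by ring
      rw [this, hc, mul_zero, add_zero]
    rw [Finset.sum_congr rfl fun v _ => hexp v, Finset.sum_comm]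
    have htel : ∀ j ∈ A, ∑ v ∈ Fintype.piFinset s, (b i (v + Pi.single j 1) *
          cupSum (l.map b) (A.erase j) (v + Pi.single j 1)
            - b i v * cupSum (l.map b) (A.erase j) v)
        = ∑ v ∈ Fintype.piFinset (Function.update s j {N}),
            b i v * cupSum (l.map b) (A.erase j) v
          - ∑ v ∈ Fintype.piFinset (Function.update s j {0}),
            b i v * cupSum (l.map b) (A.erase j) v := fun j hj =>
      sum_piFinset_telescope s j N (by simp [hs, hj])
        (fun v => b i v * cupSum (l.map b) (A.erase j) v)
    rw [Finset.sum_congr rfl htel, Finset.sum_eq_single_of_mem i (by simp [hA])]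
    · have hface : ∀ c, ∀ v ∈ Fintype.piFinset (Function.update s i {c}), v i = c := by
        intro c v hv
        simpa using Fintype.mem_piFinset.1 hv i
      rw [Finset.sum_congr rfl fun v hv => by rw [hN i v (hface N v hv), one_mul],
        Finset.sum_eq_zero (s := Fintype.piFinset (Function.update s i {0}))
          fun v hv => by rw [h0 i v (hface 0 v hv), zero_mul], sub_zero, hAi,
        ← ih hl (Function.update w i N)]
      congr 2
      ext1 k
      by_cases hk : k = i
      · subst hk; simp [hil]
      · simp [hs, hA, hk]
    · intro j hj hji
      have hjl : j ∈ l := by simpa [hA, hji] using hj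
      have hface : ∀ c, ∀ v ∈ Fintype.piFinset (Function.update s j {c}), v j = c := by
        intro c v hv
        simpa using Fintype.mem_piFinset.1 hv j
      rw [Finset.sum_eq_zero, Finset.sum_eq_zero, sub_zero]
      · intro v hv
        rw [cupSum_eq_zero_of_const (h0 j) _ (List.mem_map_of_mem hjl) _ _
          (Finset.notMem_erase j A) (hface 0 v hv), mul_zero]
      · intro v hv
        rw [cupSum_eq_zero_of_const (hN j) _ (List.mem_map_of_mem hjl) _ _
          (Finset.notMem_erase j A) (hface N v hv), mul_zero]

/-- Discrete Poincaré–Miranda theorem: if on the grid `{0, …, N}^ι` the predicate `b i` fails on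
the face `v i = 0` and holds on the face `v i = N`, then there is a unit cube on which
none of the predicates is constant. -/
theorem discrete_miranda (N : ℕ) (b : ι → (ι → ℕ) → Prop)
    (h0 : ∀ i v, v i = 0 → ¬ b i v) (hN : ∀ i v, v i = N → b i v) :
    ∃ v : ι → ℕ, (∀ i, v i < N) ∧ ∀ i, ∃ u u' : ι → ℕ, b i u ∧ ¬ b i u' ∧
      (∀ j, v j ≤ u j ∧ u j ≤ v j + 1) ∧ (∀ j, v j ≤ u' j ∧ u' j ≤ v j + 1) := by
  classical
  have hsum := sum_cupSum_eq_one N (fun i v => if b i v then (1 : ZMod 2) else 0)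
    (fun i v h => by simp [h0 i v h]) (fun i v h => by simp [hN i v h])
    (Finset.univ : Finset ι).toList (Finset.nodup_toList _) 0
  obtain ⟨v, hv, hne⟩ := Finset.exists_ne_zero_of_sum_ne_zero (hsum ▸ one_ne_zero)
  simp only [Finset.toList_toFinset, Finset.mem_univ, if_true, Fintype.mem_piFinset,
    Finset.mem_range] at hv
  refine ⟨v, hv, fun i => ?_⟩
  obtain ⟨u, u', h1, h2, h3⟩ := exists_change_of_cupSum_ne_zero _ _ _ hne
    (fun v => if b i v then (1 : ZMod 2) else 0)
    (List.mem_map_of_mem (Finset.mem_toList.2 (Finset.mem_univ i)))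
  simp only [Finset.toList_toFinset, Finset.mem_univ, if_true] at h2 h3
  by_cases hu : b i u
  · by_cases hu' : b i u'
    · simp [hu, hu'] at h1
    · exact ⟨u, u', hu, hu', h2, h3⟩
  · by_cases hu' : b i u'
    · exact ⟨u', u, hu', hu, h3, h2⟩
    · simp [hu, hu'] at h1

end DiscreteMiranda

/-! ### Writing a point as a signed sum of permuted path points. -/

section SignedSums

/-- The sign of an integer, with value `1` at `0`. -/
def sgn (z : ℤ) : ℤ := if 0 ≤ z then 1 else -1

lemma sgn_eq (z : ℤ) : sgn z = 1 ∨ sgn z = -1 := by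
  unfold sgn; split_ifs <;> simp

lemma sgn_mul_self (z : ℤ) : sgn z * z = |z| := by
  unfold sgn; split_ifs with h
  · rw [abs_of_nonneg h, one_mul]
  · rw [abs_of_neg (not_le.1 h)]; ring

lemma abs_sub_sgn_mul (z a : ℤ) : |z - sgn z * a| = |(|z| - a)| := by
  unfold sgn; split_ifs with h
  · rw [abs_of_nonneg h, one_mul]
  · rw [abs_of_neg (not_le.1 h), ← abs_neg (-z - a)]; congr 1; ring

lemma abs_sgn_mul (z a : ℤ) : |sgn z * a| = |a| := by
  rcases sgn_eq z with h | h <;> simp [h]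

/-- Start from `x` and successively move by `a 0, a 1, …` towards the origin. -/
def towardsZero (x : ℤ) (a : ℕ → ℤ) : ℕ → ℤ
  | 0 => x
  | m + 1 => towardsZero x a m - sgn (towardsZero x a m) * a m

lemma abs_towardsZero_succ (x : ℤ) (a : ℕ → ℤ) (m : ℕ) :
    |towardsZero x a (m + 1)| = |(|towardsZero x a m| - a m)| :=
  abs_sub_sgn_mul _ _

lemma abs_towardsZero_le {x n : ℤ} {a : ℕ → ℤ} (hx : |x| ≤ n) (ha : ∀ m, 0 ≤ a m ∧ a m ≤ n)
    (m : ℕ) : |towardsZero x a m| ≤ n := by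
  induction m with
  | zero => exact hx
  | succ m ih =>
    rw [abs_towardsZero_succ, abs_le]
    have := ha m
    have := abs_nonneg (towardsZero x a m)
    constructor <;> linarith

/-- The signed position may jump when its sign flips, but its absolute value evolves by z ↦ |z - a|,
which is Lipschitz. This is the continuity that Poincaré–Miranda needs. -/
lemma abs_abs_towardsZero_sub_le (x : ℤ) (a a' : ℕ → ℤ) (m : ℕ) :
    |(|towardsZero x a m| - |towardsZero x a' m|)| ≤ ∑ j ∈ Finset.range m, |a j - a' j| := by
  induction m with
  | zero => simp [towardsZero]
  | succ m ih =>
    rw [abs_towardsZero_succ, abs_towardsZero_succ, Finset.sum_range_succ]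
    refine (abs_abs_sub_abs_le_abs_sub _ _).trans ?_
    have h := abs_sub (|towardsZero x a m| - |towardsZero x a' m|) (a m - a' m)
    have e : |towardsZero x a m| - a m - (|towardsZero x a' m| - a' m)
      = |towardsZero x a m| - |towardsZero x a' m| - (a m - a' m) := by ring
    rw [e]
    linarith

/-- Let `γ` be a lattice path in `[-n, n]^d` from the origin to a point whose `k`-th coordinate is
`± n`. Then every lattice point of `[-n, n]^d` is, up to a bounded error, a sum of `d` vectors
obtained by signed coordinate permutations from points of `γ`, with controlled partial sums. -/
theorem exists_signed_sum {d T : ℕ} {n : ℤ} (γ : ℕ → Site d) (k : Fin d)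
    (h0 : γ 0 = 0) (hT : |γ T k| = n) (hb : ∀ t ≤ T, ∀ i, |γ t i| ≤ n)
    (hstep : ∀ t < T, ∀ i, |γ (t + 1) i - γ t i| ≤ 1) (x : Site d) (hx : ∀ i, |x i| ≤ n) :
    ∃ y : ℕ → Site d, y 0 = 0 ∧ (∀ m i, |y m i| ≤ 3 * n) ∧
      (∀ m < d, ∃ t ≤ T, ∃ (τ : Equiv.Perm (Fin d)) (s : Fin d → ℤ), (∀ i, s i = 1 ∨ s i = -1) ∧
        ∀ i, y (m + 1) i = y m i + s i * γ t (τ i)) ∧ ∀ i, |x i - y d i| ≤ d := by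
  classical
  -- The `j`-th summand has coordinates `j` and `k` exchanged, so the coordinate that reaches `± n`
  -- along the path acts on coordinate `j`.
  set τ : Fin d → Equiv.Perm (Fin d) := fun j => Equiv.swap j k with hτ
  have hτj : ∀ j, τ j j = k := fun j => Equiv.swap_apply_left j k
  set g : (Fin d → ℕ) → Fin d → Fin d → ℤ := fun t i j => |γ (t j) (τ j i)| with hg
  -- In coordinate `i` the summand `i` is left out (value 0) and saved for the end: its size runs
  -- from 0 to `n` and has to match the remainder left by the others. `F` is the mismatch.
  set a : (Fin d → ℕ) → Fin d → ℕ → ℤ := fun t i m =>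
    if h : m < d then (if (⟨m, h⟩ : Fin d) = i then 0 else g t i ⟨m, h⟩) else 0 with ha
  set F : (Fin d → ℕ) → Fin d → ℤ := fun t i => |towardsZero (x i) (a t i) d| - g t i i with hF
  have hn : 0 ≤ n := (abs_nonneg _).trans hT.le
  have hgb : ∀ t, (∀ j, t j ≤ T) → ∀ i j, 0 ≤ g t i j ∧ g t i j ≤ n := fun t ht i j =>
    ⟨abs_nonneg _, hb _ (ht j) _⟩
  have hab : ∀ t, (∀ j, t j ≤ T) → ∀ i m, 0 ≤ a t i m ∧ a t i m ≤ n := by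
    intro t ht i m
    simp only [ha]
    split_ifs
    · exact ⟨le_rfl, hn⟩
    · exact hgb t ht _ _
    · exact ⟨le_rfl, hn⟩
  have hEb : ∀ t, (∀ j, t j ≤ T) → ∀ i, |towardsZero (x i) (a t i) d| ≤ n := fun t ht i =>
    abs_towardsZero_le (hx i) (hab t ht i) d
  have hglip : ∀ v u : Fin d → ℕ, (∀ j, v j < T) → (∀ j, v j ≤ u j ∧ u j ≤ v j + 1) →
      ∀ i j, |g v i j - g u i j| ≤ 1 := by
    intro v u hv hu i j
    refine (abs_abs_sub_abs_le_abs_sub _ _).trans ?_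
    rcases (by have := hu j; omega : u j = v j ∨ u j = v j + 1) with h | h
    · simp [h]
    · rw [h, abs_sub_comm]; exact hstep _ (hv j) _
  -- The `d - 1` off-diagonal summands and the diagonal one each change by at most 1 inside a unit
  -- cube.
  have hFlip : ∀ v u : Fin d → ℕ, (∀ j, v j < T) → (∀ j, v j ≤ u j ∧ u j ≤ v j + 1) →
      ∀ i, |F v i - F u i| ≤ d := by
    intro v u hv hu i
    have h1 := abs_abs_towardsZero_sub_le (x i) (a v i) (a u i) d
    have h2 : ∑ j ∈ Finset.range d, |a v i j - a u i j|
        ≤ ∑ j ∈ Finset.range d, (if j = (i : ℕ) then (0 : ℤ) else 1) := by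
      refine Finset.sum_le_sum fun j hj => ?_
      have hj' := Finset.mem_range.1 hj
      by_cases h : j = (i : ℕ)
      · have : (⟨j, hj'⟩ : Fin d) = i := Fin.ext h
        simp [ha, h]
      · have : (⟨j, hj'⟩ : Fin d) ≠ i := fun e => h (congrArg Fin.val e)
        simp only [ha, hj', this, h, dif_pos, if_false]
        exact hglip v u hv hu _ _
    have h3 : ∑ j ∈ Finset.range d, (if j = (i : ℕ) then (0 : ℤ) else 1) = d - 1 := by
      have : ∀ j, (if j = (i : ℕ) then (0 : ℤ) else 1) = 1 - if j = (i : ℕ) then 1 else 0 := by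
        intro j; split_ifs <;> simp
      simp only [this, Finset.sum_sub_distrib, Finset.sum_ite_eq', Finset.mem_range, i.2, if_true]
      simp
    have h4 := hglip v u hv hu i i
    have h5 := abs_sub (|towardsZero (x i) (a v i) d| - |towardsZero (x i) (a u i) d|)
      (g v i i - g u i i)
    have e : F v i - F u i = |towardsZero (x i) (a v i) d| - |towardsZero (x i) (a u i) d|
      - (g v i i - g u i i) := by simp only [hF]; ring
    rw [e]
    linarith
  have hF0 : ∀ u i, u i = 0 → 0 ≤ F u i := by
    intro u i hu
    simp [hF, hg, hu, h0]
  have hFT : ∀ u, (∀ j, u j ≤ T) → ∀ i, u i = T → F u i ≤ 0 := by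
    intro u hu i hi
    have := hEb u hu i
    simp only [hF, hg, hi, hτj, hT]
    linarith
  obtain ⟨t, htT, ht⟩ : ∃ t : Fin d → ℕ, (∀ j, t j ≤ T) ∧ ∀ i, |F t i| ≤ d := by
    rcases Nat.eq_zero_or_pos T with hT0 | hTpos
    · refine ⟨0, by simp, fun i => ?_⟩
      have e1 := hF0 0 i rfl
      have e2 := hFT 0 (by simp) i hT0.symm
      rw [le_antisymm e2 e1]; simp
    -- The conditions `u i = T` and `u i ≠ 0` force the boundary hypotheses for all `u`: `F` may
    -- vanish on the face at 0, and its sign at `T` is known only inside the grid.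
    obtain ⟨v, hv, hvi⟩ := discrete_miranda T
      (fun i u => u i = T ∨ (u i ≠ 0 ∧ F u i ≤ 0))
      (fun i u hu => by simp [hu, hTpos.ne]) (fun i u hu => Or.inl hu)
    refine ⟨v, fun j => (hv j).le, fun i => ?_⟩
    obtain ⟨u, u', h1, h2, h3, h4⟩ := hvi i
    have hule : ∀ j, u j ≤ T := fun j => (h3 j).2.trans (hv j)
    have hu : F u i ≤ 0 := h1.elim (fun h => hFT u hule i h) fun h => h.2
    have hu' : 0 ≤ F u' i := by
      by_cases hz : u' i = 0
      · exact hF0 u' i hz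
      · by_contra hneg
        exact h2 (Or.inr ⟨hz, (not_le.1 hneg).le⟩)
    have e1 := abs_le.1 (hFlip v u hv h3 i)
    have e2 := abs_le.1 (hFlip v u' hv h4 i)
    rw [abs_le]
    constructor <;> linarith [e1.1, e1.2, e2.1, e2.2]
  set r : Fin d → ℕ → ℤ := fun i m => towardsZero (x i) (a t i) m with hr
  have hr0 : ∀ i, r i 0 = x i := fun i => rfl
  have hrs : ∀ i m, r i (m + 1) = r i m - sgn (r i m) * a t i m := fun i m => rfl
  -- Partial sums: the amount removed from `x i` so far, plus the diagonal contribution once summand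
  -- `i` has been used. Each of the three terms has size at most `n`, whence `3 * n`.
  refine ⟨fun m i => x i - r i m + if (i : ℕ) < m then sgn (r i d) * g t i i else 0,
    ?_, ?_, ?_, ?_⟩
  · ext i; simp [hr0]
  · intro m i
    have h1 : |r i m| ≤ n := abs_towardsZero_le (hx i) (hab t htT i) m
    have h2 : |if (i : ℕ) < m then sgn (r i d) * g t i i else 0| ≤ n := by
      split_ifs
      · rw [abs_sgn_mul, abs_of_nonneg (hgb t htT i i).1]; exact (hgb t htT i i).2
      · simpa using hn
    have h3 := abs_add_le (x i - r i m) (if (i : ℕ) < m then sgn (r i d) * g t i i else 0)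
    have h4 := abs_sub (x i) (r i m)
    have := hx i
    simp only
    linarith
  · intro m hm
    refine ⟨t ⟨m, hm⟩, htT _, τ ⟨m, hm⟩, fun i =>
      (if (i : ℕ) = m then sgn (r i d) else sgn (r i m)) * sgn (γ (t ⟨m, hm⟩) (τ ⟨m, hm⟩ i)),
      fun i => ?_, fun i => ?_⟩
    · rcases sgn_eq (γ (t ⟨m, hm⟩) (τ ⟨m, hm⟩ i)) with h | h <;>
      rcases sgn_eq (r i d) with h' | h' <;> rcases sgn_eq (r i m) with h'' | h'' <;>
      by_cases e : (i : ℕ) = m <;> simp [h, h', h'', e]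
    · have hmul : ∀ z : ℤ, z * sgn (γ (t ⟨m, hm⟩) (τ ⟨m, hm⟩ i)) * γ (t ⟨m, hm⟩) (τ ⟨m, hm⟩ i)
          = z * g t i ⟨m, hm⟩ := fun z => by rw [mul_assoc, sgn_mul_self]
      simp only [hmul, hrs]
      by_cases h : (i : ℕ) = m
      · have hi : (⟨m, hm⟩ : Fin d) = i := Fin.ext h.symm
        have ha0 : a t i m = 0 := by simp [ha, hi]
        simp [h, hi, ha0]
      · have hi : (⟨m, hm⟩ : Fin d) ≠ i := fun e => h (congrArg Fin.val e).symm
        have ha0 : a t i m = g t i ⟨m, hm⟩ := by simp [ha, hi, hm]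
        have hlt : (i : ℕ) < m + 1 ↔ (i : ℕ) < m := by omega
        simp only [hlt, h, if_false, ha0]
        ring
  · intro i
    simp only [i.2, if_true]
    have : x i - (x i - r i d + sgn (r i d) * g t i i) = r i d - sgn (r i d) * g t i i := by ring
    rw [this, abs_sub_sgn_mul]
    exact ht i

end SignedSums

/-! ### Open paths and their transport. -/

section Paths

variable {d : ℕ}

@[simp] lemma dist1_self (x : Site d) : dist1 x x = 0 := by simp [dist1]

lemma abs_sub_le_dist1 (x y : Site d) (i : Fin d) : |x i - y i| ≤ dist1 x y :=
  Finset.single_le_sum (f := fun i => |x i - y i|) (fun _ _ => abs_nonneg _) (Finset.mem_univ i)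

/-- One step of an open path in `S`. -/
def OpenStep (ω : Config d) (S : Set (Site d)) (a b : Site d) : Prop :=
  dist1 b a ≤ 1 ∧ b ∈ S ∧ ω b = true

lemma connectedIn_iff {ω : Config d} {S : Set (Site d)} {x y : Site d} :
    ConnectedIn ω S x y ↔ (x ∈ S ∧ ω x = true) ∧ Relation.ReflTransGen (OpenStep ω S) x y := by
  constructor
  · rintro ⟨k, γ, rfl, rfl, h1, h2⟩
    refine ⟨h2 0 (Nat.zero_le _), ?_⟩
    have : ∀ i ≤ k, Relation.ReflTransGen (OpenStep ω S) (γ 0) (γ i) := by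
      intro i
      induction i with
      | zero => intro _; exact .refl
      | succ i ih => intro hi; exact (ih (by omega)).tail ⟨h1 i hi, h2 _ hi⟩
    exact this k le_rfl
  · rintro ⟨hx, h⟩
    induction h with
    | refl => exact ⟨0, fun _ => x, rfl, rfl, by simp, fun _ _ => hx⟩
    | @tail b c _ hbc ih =>
      obtain ⟨k, γ, h0, hk, h1, h2⟩ := ih
      refine ⟨k + 1, fun i => if i ≤ k then γ i else c, by simp [h0], by simp, ?_, ?_⟩
      · intro i hi
        rcases Nat.lt_succ_iff_lt_or_eq.1 hi with h | rfl
        · have h' : i + 1 ≤ k := h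
          simp only [h', h.le, if_true]
          exact h1 i h
        · simpa [hk] using hbc.1
      · intro i _
        by_cases h : i ≤ k
        · simpa [h] using h2 i h
        · simpa [h] using hbc.2

lemma ConnectedIn.left_mem {ω : Config d} {S : Set (Site d)} {x y : Site d}
    (h : ConnectedIn ω S x y) : x ∈ S ∧ ω x = true := (connectedIn_iff.1 h).1

lemma ConnectedIn.right_mem {ω : Config d} {S : Set (Site d)} {x y : Site d}
    (h : ConnectedIn ω S x y) : y ∈ S ∧ ω y = true := by
  obtain ⟨hx, h⟩ := connectedIn_iff.1 h
  rcases h.cases_tail with rfl | ⟨_, _, h⟩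
  · exact hx
  · exact h.2

lemma ConnectedIn.refl {ω : Config d} {S : Set (Site d)} {x : Site d} (hx : x ∈ S)
    (hω : ω x = true) : ConnectedIn ω S x x := connectedIn_iff.2 ⟨⟨hx, hω⟩, .refl⟩

lemma ConnectedIn.tail {ω : Config d} {S : Set (Site d)} {x y z : Site d}
    (h : ConnectedIn ω S x y) (hyz : dist1 z y ≤ 1) (hz : z ∈ S) (hω : ω z = true) :
    ConnectedIn ω S x z := by
  obtain ⟨hx, h⟩ := connectedIn_iff.1 h
  exact connectedIn_iff.2 ⟨hx, h.tail ⟨hyz, hz, hω⟩⟩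

lemma ConnectedIn.trans {ω : Config d} {S : Set (Site d)} {x y z : Site d}
    (h : ConnectedIn ω S x y) (h' : ConnectedIn ω S y z) : ConnectedIn ω S x z := by
  obtain ⟨hx, h⟩ := connectedIn_iff.1 h
  exact connectedIn_iff.2 ⟨hx, h.trans (connectedIn_iff.1 h').2⟩

/-- A map of configurations and sites that preserves open sites and neighbours preserves
connections. -/
lemma ConnectedIn.map {ω ω' : Config d} {S S' : Set (Site d)} {x y : Site d}
    (h : ConnectedIn ω S x y) (e : Site d → Site d)
    (he : ∀ a b, dist1 a b ≤ 1 → dist1 (e a) (e b) ≤ 1)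
    (hS : ∀ a ∈ S, ω a = true → e a ∈ S' ∧ ω' (e a) = true) :
    ConnectedIn ω' S' (e x) (e y) := by
  obtain ⟨k, γ, rfl, rfl, h1, h2⟩ := h
  exact ⟨k, fun i => e (γ i), rfl, rfl, fun i hi => he _ _ (h1 i hi),
    fun i hi => hS _ (h2 i hi).1 (h2 i hi).2⟩

lemma ConnectedIn.mono {ω ω' : Config d} {S S' : Set (Site d)} {x y : Site d}
    (h : ConnectedIn ω S x y) (hS : ∀ a ∈ S, ω a = true → a ∈ S' ∧ ω' a = true) :
    ConnectedIn ω' S' x y := h.map id (fun _ _ h => h) hS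

end Paths

/-! ### Measurability with respect to the sites used. -/

section Measurability

variable {d : ℕ}

/-- The σ-algebra generated by the states of the sites of `S`. -/
@[reducible] def siteSigma (S : Set (Site d)) : MeasurableSpace (Config d) :=
  ⨆ i ∈ S, MeasurableSpace.comap (fun ω : Config d => ω i) ⊤

lemma siteSigma_le (S : Set (Site d)) : siteSigma S ≤ MeasurableSpace.pi :=
  iSup₂_le fun i _ => (measurable_pi_apply i).comap_le

lemma measurableSet_siteSigma_state {S : Set (Site d)} {a : Site d} (ha : a ∈ S) (b : Bool) :
    MeasurableSet[siteSigma S] {ω : Config d | ω a = b} := by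
  refine (le_iSup₂_of_le (f := fun (i : Site d) (_ : i ∈ S) =>
    MeasurableSpace.comap (fun ω : Config d => ω i) ⊤) a ha le_rfl) _ ?_
  exact ⟨{b}, trivial, rfl⟩

/-- `z` can be reached from `x` by an open path in `S` of length `k`. -/
def ReachIn (ω : Config d) (S : Set (Site d)) (x : Site d) : ℕ → Site d → Prop
  | 0, z => z = x ∧ x ∈ S ∧ ω x = true
  | k + 1, z => ∃ y, dist1 z y ≤ 1 ∧ z ∈ S ∧ ReachIn ω S x k y ∧ ω z = true

/-- Indexing by length makes a connection a countable union of events built recursively from states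
of sites of `S`. -/
lemma connectedIn_iff_reachIn {ω : Config d} {S : Set (Site d)} {x y : Site d} :
    ConnectedIn ω S x y ↔ ∃ k, ReachIn ω S x k y := by
  constructor
  · rw [connectedIn_iff]
    rintro ⟨hx, h⟩
    induction h with
    | refl => exact ⟨0, rfl, hx⟩
    | tail _ hbc ih =>
      obtain ⟨k, hk⟩ := ih
      exact ⟨k + 1, _, hbc.1, hbc.2.1, hk, hbc.2.2⟩
  · rintro ⟨k, hk⟩
    induction k generalizing y with
    | zero => obtain ⟨rfl, hx, hω⟩ := hk; exact .refl hx hω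
    | succ k ih =>
      obtain ⟨z, h1, h2, h3, h4⟩ := hk
      exact (ih h3).tail h1 h2 h4

lemma measurableSet_reachIn (S : Set (Site d)) (x : Site d) (k : ℕ) : ∀ y,
    MeasurableSet[siteSigma S] {ω : Config d | ReachIn ω S x k y} := by
  induction k with
  | zero =>
    intro y
    by_cases h : y = x ∧ x ∈ S
    · simpa [ReachIn, h.1, h.2] using measurableSet_siteSigma_state h.2 true
    · have : {ω : Config d | ReachIn ω S x 0 y} = ∅ := by
        ext ω
        simp only [ReachIn, Set.mem_ofPred_eq, Set.mem_empty_iff_false, iff_false]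
        exact fun h' => h ⟨h'.1, h'.2.1⟩
      rw [this]
      exact @MeasurableSet.empty _ (siteSigma S)
  | succ k ih =>
    intro z
    by_cases hz : z ∈ S
    · have : {ω : Config d | ReachIn ω S x (k + 1) z}
          = ⋃ y ∈ {y : Site d | dist1 z y ≤ 1},
            ({ω | ReachIn ω S x k y} ∩ {ω | ω z = true}) := by
        ext ω
        simp only [ReachIn, hz, true_and, Set.mem_iUnion, Set.mem_ofPred_eq, Set.mem_inter_iff,
          exists_prop]
      rw [this]
      exact MeasurableSet.biUnion (Set.to_countable _) fun y _ =>
        (ih y).inter (measurableSet_siteSigma_state hz true)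
    · have : {ω : Config d | ReachIn ω S x (k + 1) z} = ∅ := by
        ext ω
        simp [ReachIn, hz]
      rw [this]
      exact @MeasurableSet.empty _ (siteSigma S)

lemma measurableSet_siteSigma_connEvent (S : Set (Site d)) (x y : Site d) :
    MeasurableSet[siteSigma S] (connEvent S x y) := by
  have : connEvent S x y = ⋃ k, {ω : Config d | ReachIn ω S x k y} := by
    ext ω
    simp [connEvent, connectedIn_iff_reachIn]
  rw [this]
  exact MeasurableSet.iUnion fun k => measurableSet_reachIn S x k y

lemma measurableSet_connEvent (S : Set (Site d)) (x y : Site d) :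
    MeasurableSet (connEvent S x y) :=
  siteSigma_le S _ (measurableSet_siteSigma_connEvent S x y)

/-- The event that `x` is connected to infinity by an open path in `S`. -/
def infEvent (S : Set (Site d)) (x : Site d) : Set (Config d) :=
  {ω | {y | ConnectedIn ω S x y}.Infinite}

lemma measurableSet_siteSigma_infEvent (S : Set (Site d)) (x : Site d) :
    MeasurableSet[siteSigma S] (infEvent S x) := by
  classical
  have : infEvent S x = ⋂ F : Finset (Site d), ⋃ y ∈ {y : Site d | y ∉ F}, connEvent S x y := by
    ext ω
    simp only [infEvent, connEvent, Set.mem_ofPred_eq, Set.mem_iInter, Set.mem_iUnion,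
      exists_prop]
    constructor
    · intro h F
      obtain ⟨y, hy, hyF⟩ := h.exists_notMem_finset F
      exact ⟨y, hyF, hy⟩
    · intro h hfin
      obtain ⟨y, hy, hy'⟩ := h hfin.toFinset
      exact hy (hfin.mem_toFinset.2 hy')
  rw [this]
  exact MeasurableSet.iInter fun F => MeasurableSet.biUnion (Set.to_countable _) fun y _ =>
    measurableSet_siteSigma_connEvent S x y

lemma measurableSet_infEvent (S : Set (Site d)) (x : Site d) : MeasurableSet (infEvent S x) :=
  siteSigma_le S _ (measurableSet_siteSigma_infEvent S x)

end Measurability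

/-! ### Independence, Harris' inequality and invariance. -/

section Measure

variable {d : ℕ}

instance (p : unitInterval) : IsProbabilityMeasure (perc d p) := by
  unfold perc; infer_instance

lemma perc_real_inter_of_disjoint (p : unitInterval) {S T : Set (Site d)} (hST : Disjoint S T)
    {A B : Set (Config d)} (hA : MeasurableSet[siteSigma S] A)
    (hB : MeasurableSet[siteSigma T] B) :
    (perc d p).real (A ∩ B) = (perc d p).real A * (perc d p).real B := by
  have h : iIndepFun (fun (i : Site d) (ω : Config d) => ω i) (perc d p) :=
    iIndepFun_infinitePi (P := fun _ : Site d => bernoulliMeasure true false p)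
      (X := fun _ b => b) fun _ => measurable_id
  have hI := indep_iSup_of_disjoint (fun i => (measurable_pi_apply i).comap_le) h hST
  have := (Indep_iff _ _ _).1 hI A B hA hB
  simp only [measureReal_def, this, ENNReal.toReal_mul]

/-- `A` is determined by the states of the sites of `K`. -/
def DeterminedBy (A : Set (Config d)) (K : Finset (Site d)) : Prop :=
  ∀ ω ω' : Config d, (∀ a ∈ K, ω a = ω' a) → ω ∈ A → ω' ∈ A

/-- `A` is an increasing event. -/
def Increasing (A : Set (Config d)) : Prop :=
  ∀ ω ω' : Config d, (∀ a, ω a = true → ω' a = true) → ω ∈ A → ω' ∈ A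

/-- Extend a configuration on a finite set by closed sites. -/
def extendClosed (K : Finset (Site d)) (η : K → Bool) : Config d :=
  fun x => if h : x ∈ K then η ⟨x, h⟩ else false

/-- The mass of a Bernoulli variable. -/
def siteWeight (p : unitInterval) (b : Bool) : ℝ := if b then p else 1 - p

lemma siteWeight_nonneg (p : unitInterval) (b : Bool) : 0 ≤ siteWeight p b := by
  unfold siteWeight; split_ifs
  · exact p.2.1
  · linarith [p.2.2]

-- The probability becomes a polynomial in `p` and a finite weighted sum, which yields both
-- continuity in `p` and access to the FKG inequality.
open Classical in
lemma perc_real_eq_sum (p : unitInterval) {A : Set (Config d)} {K : Finset (Site d)}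
    (hA : DeterminedBy A K) :
    (perc d p).real A = ∑ η : K → Bool, (∏ i, siteWeight p (η i)) *
      (if extendClosed K η ∈ A then 1 else 0) := by
  have hpre : A = K.restrict ⁻¹' {η : K → Bool | extendClosed K η ∈ A} := by
    ext ω
    simp only [Set.mem_preimage, Set.mem_ofPred_eq]
    constructor
    · exact hA _ _ fun a ha => by simp [extendClosed, ha]
    · exact hA _ _ fun a ha => by simp [extendClosed, ha]
  have hmap : (perc d p).map K.restrict
      = Measure.pi (fun _ : K => bernoulliMeasure true false p) :=
    Measure.infinitePi_map_restrict (fun _ : Site d => bernoulliMeasure true false p)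
  have hm : Measurable (K.restrict : Config d → K → Bool) := by fun_prop
  have hs : MeasurableSet {η : K → Bool | extendClosed K η ∈ A} := Set.toFinite _ |>.measurableSet
  conv_lhs => rw [hpre]
  rw [← map_measureReal_apply hm hs, hmap]
  have hfs : {η : K → Bool | extendClosed K η ∈ A}
      = ((Finset.univ.filter fun η => extendClosed K η ∈ A : Finset (K → Bool)) :
        Set (K → Bool)) := by ext; simp
  rw [hfs, ← sum_measureReal_singleton, Finset.sum_filter]
  refine Finset.sum_congr rfl fun η _ => ?_
  split_ifs
  · rw [mul_one, measureReal_def, Measure.pi_singleton, ENNReal.toReal_prod]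
    refine Finset.prod_congr rfl fun i _ => ?_
    rw [← measureReal_def, bernoulliMeasure_real_apply _ (MeasurableSet.singleton _)]
    cases η i <;> simp [siteWeight]
  · rw [mul_zero]

lemma continuous_perc_real {A : Set (Config d)} {K : Finset (Site d)} (hA : DeterminedBy A K) :
    Continuous fun p => (perc d p).real A := by
  simp only [perc_real_eq_sum _ hA]
  refine continuous_finsetSum _ fun η _ => Continuous.mul ?_ continuous_const
  refine continuous_finsetProd _ fun i _ => ?_
  unfold siteWeight
  split_ifs <;> fun_prop

/-- Harris' inequality for increasing events that depend on finitely many sites. -/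
lemma harris (p : unitInterval) {A B : Set (Config d)} {K : Finset (Site d)}
    (hA : DeterminedBy A K) (hB : DeterminedBy B K) (iA : Increasing A) (iB : Increasing B) :
    (perc d p).real A * (perc d p).real B ≤ (perc d p).real (A ∩ B) := by
  classical
  have hAB : DeterminedBy (A ∩ B) K := fun ω ω' h hω => ⟨hA ω ω' h hω.1, hB ω ω' h hω.2⟩
  have huniv : DeterminedBy (Set.univ : Set (Config d)) K := fun _ _ _ _ => trivial
  have h1 := perc_real_eq_sum p huniv
  simp only [Set.mem_univ, if_true, mul_one, probReal_univ] at h1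
  have hmono : ∀ {C : Set (Config d)}, Increasing C → Monotone fun η : K → Bool =>
      if extendClosed K η ∈ C then (1 : ℝ) else 0 := by
    intro C hC η η' h
    by_cases hη : extendClosed K η ∈ C
    · have : extendClosed K η' ∈ C := by
        refine hC _ _ (fun a ha => ?_) hη
        by_cases haK : a ∈ K
        · simp only [extendClosed, haK, dif_pos] at ha ⊢
          have := h ⟨a, haK⟩
          rw [ha] at this
          exact top_le_iff.1 this
        · simp [extendClosed, haK] at ha
      simp [hη, this]
    · simp only [hη, if_false]
      split_ifs <;> norm_num
  have hind : ∀ C : Set (Config d), (0 : (K → Bool) → ℝ) ≤ fun η =>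
      if extendClosed K η ∈ C then (1 : ℝ) else 0 := by
    intro C η
    simp only [Pi.zero_apply]
    split_ifs <;> norm_num
  have := fkg (α := K → Bool) (μ := fun η => ∏ i, siteWeight p (η i))
    (f := fun η => if extendClosed K η ∈ A then (1 : ℝ) else 0)
    (g := fun η => if extendClosed K η ∈ B then (1 : ℝ) else 0)
    (fun η => Finset.prod_nonneg fun i _ => siteWeight_nonneg _ _) (hind A) (hind B)
    -- For product weights the lattice condition of FKG holds with equality, site by site.
    (hmono iA) (hmono iB) (fun a b => by
      rw [← Finset.prod_mul_distrib, ← Finset.prod_mul_distrib]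
      refine le_of_eq (Finset.prod_congr rfl fun i _ => ?_)
      simp only [Pi.inf_apply, Pi.sup_apply]
      cases a i <;> cases b i <;> simp [mul_comm])
  rw [← h1, one_mul] at this
  rw [perc_real_eq_sum p hA, perc_real_eq_sum p hB, perc_real_eq_sum p hAB]
  refine this.trans (le_of_eq (Finset.sum_congr rfl fun η _ => ?_))
  by_cases hηA : extendClosed K η ∈ A <;> by_cases hηB : extendClosed K η ∈ B <;>
    simp [hηA, hηB]

lemma increasing_connEvent (S : Set (Site d)) (x y : Site d) : Increasing (connEvent S x y) :=
  fun _ _ h hω => ConnectedIn.mono hω fun a ha hωa => ⟨ha, h a hωa⟩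

lemma determinedBy_connEvent {S : Set (Site d)} {K : Finset (Site d)} (hS : S ⊆ K)
    (x y : Site d) : DeterminedBy (connEvent S x y) K :=
  fun _ _ h hω => ConnectedIn.mono hω fun a ha hωa => ⟨ha, h a (hS ha) ▸ hωa⟩

lemma perc_map_comp (p : unitInterval) (e : Site d ≃ Site d) :
    (perc d p).map (fun ω i => ω (e i)) = perc d p :=
  Measure.map_infinitePi_infinitePi_of_inj
    (P := fun _ : Site d => bernoulliMeasure true false p) e.injective

lemma perc_real_preimage_comp (p : unitInterval) (e : Site d ≃ Site d) {A : Set (Config d)}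
    (hA : MeasurableSet A) :
    (perc d p).real {ω | (fun i => ω (e i)) ∈ A} = (perc d p).real A := by
  conv_rhs => rw [← perc_map_comp p e]
  rw [map_measureReal_apply (by fun_prop) hA]
  rfl

lemma perc_real_connEvent_le_map (p : unitInterval) (e : Site d ≃ Site d)
    (he : ∀ a b, dist1 a b ≤ 1 → dist1 (e a) (e b) ≤ 1) {S S' : Set (Site d)}
    (hS : ∀ a ∈ S, e a ∈ S') (x y : Site d) :
    (perc d p).real (connEvent S x y) ≤ (perc d p).real (connEvent S' (e x) (e y)) := by
  rw [← perc_real_preimage_comp p e (measurableSet_connEvent S x y)]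
  refine measureReal_mono fun ω hω => ?_
  have hω : ConnectedIn (fun i => ω (e i)) S x y := hω
  exact hω.map e he fun a ha hωa => ⟨hS a ha, hωa⟩

lemma dist1_add_right (x y a : Site d) : dist1 (x + a) (y + a) = dist1 x y := by
  simp [dist1]

lemma perc_real_infEvent_le_theta (p : unitInterval) (x : Site d) :
    (perc d p).real (infEvent Set.univ x) ≤ theta d p := by
  rw [← perc_real_preimage_comp p (Equiv.addRight (-x)) (measurableSet_infEvent _ x)]
  refine measureReal_mono fun ω hω => ?_
  have hω : {y | ConnectedIn (fun i => ω (i + -x)) Set.univ x y}.Infinite := hω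
  refine (hω.image (f := fun y => y + -x) (add_left_injective (-x)).injOn).mono ?_
  rintro _ ⟨y, hy, rfl⟩
  have hy : ConnectedIn (fun i => ω (i + -x)) Set.univ x y := hy
  have := hy.map (ω' := ω) (S' := Set.univ) (fun y => y + -x)
    (fun a b h => by rwa [dist1_add_right]) fun a _ ha => ⟨trivial, ha⟩
  rw [add_neg_cancel] at this
  exact this

end Measure

/-! ### Expected exits from a finite set at the critical point. -/

section Criticality

variable {d : ℕ}

/-- The event that the origin is connected inside `S` to a neighbour of `y`. -/
def exitEvent (S : Finset (Site d)) (y : Site d) : Set (Config d) :=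
  {ω | ∃ x ∈ S, dist1 y x ≤ 1 ∧ ConnectedIn ω S 0 x}

lemma determinedBy_exitEvent (S : Finset (Site d)) (y : Site d) :
    DeterminedBy (exitEvent S y) S := by
  rintro ω ω' h ⟨x, hx, hxy, hc⟩
  exact ⟨x, hx, hxy, determinedBy_connEvent subset_rfl 0 x ω ω' h hc⟩

lemma increasing_exitEvent (S : Finset (Site d)) (y : Site d) : Increasing (exitEvent S y) := by
  rintro ω ω' h ⟨x, hx, hxy, hc⟩
  exact ⟨x, hx, hxy, increasing_connEvent _ 0 x ω ω' h hc⟩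

open Classical in
/-- The open cluster of the origin inside the finite set `S`. -/
noncomputable def clusterIn (S : Finset (Site d)) (ω : Config d) : Finset (Site d) :=
  S.filter fun x => ConnectedIn ω S 0 x

open Classical in
/-- The sites of `S` at distance at most one from `C`. -/
noncomputable def neighborhoodIn (S C : Finset (Site d)) : Finset (Site d) :=
  S.filter fun x => ∃ c ∈ C, dist1 x c ≤ 1

lemma mem_clusterIn {S : Finset (Site d)} {ω : Config d} {x : Site d} :
    x ∈ clusterIn S ω ↔ ConnectedIn ω S 0 x := by
  simp only [clusterIn, Finset.mem_filter, and_iff_right_iff_imp]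
  exact fun h => h.right_mem.1

lemma clusterIn_subset (S : Finset (Site d)) (ω : Config d) : clusterIn S ω ⊆ S :=
  fun _ hx => (mem_clusterIn.1 hx).right_mem.1

/-- The cluster is `C` exactly when `C` is open and its neighbours in `S` are closed. The witness
`ω₀` ensures that `C` is connected to the origin; for empty `C` the right side would be the whole
space. -/
lemma setOf_clusterIn_eq {S C : Finset (Site d)} {ω₀ : Config d} (h0 : clusterIn S ω₀ = C)
    (hC : C.Nonempty) :
    {ω | clusterIn S ω = C} = (⋂ a ∈ C, {ω : Config d | ω a = true}) ∩
      ⋂ a ∈ neighborhoodIn S C, ⋂ (_ : a ∉ C), {ω | ω a = false} := by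
  ext ω
  simp only [Set.mem_ofPred_eq, Set.mem_inter_iff, Set.mem_iInter]
  constructor
  · rintro rfl
    refine ⟨fun a ha => (mem_clusterIn.1 ha).right_mem.2, fun a ha haC => ?_⟩
    simp only [neighborhoodIn, Finset.mem_filter] at ha
    obtain ⟨haS, c, hc, hac⟩ := ha
    by_contra hω
    exact haC (mem_clusterIn.2 ((mem_clusterIn.1 hc).tail hac haS (by simpa using hω)))
  · rintro ⟨h1, h2⟩
    have h0C : (0 : Site d) ∈ C := by
      obtain ⟨c, hc⟩ := hC
      rw [← h0, mem_clusterIn] at hc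
      rw [← h0, mem_clusterIn]
      exact .refl hc.left_mem.1 hc.left_mem.2
    have h0' : (0 : Site d) ∈ S := by
      rw [← h0, mem_clusterIn] at h0C
      exact h0C.right_mem.1
    ext x
    rw [mem_clusterIn]
    constructor
    · rw [connectedIn_iff]
      rintro ⟨_, h⟩
      induction h with
      | refl => exact h0C
      | @tail b c _ hbc ih =>
        by_contra hc
        have := h2 c (by
          simp only [neighborhoodIn, Finset.mem_filter]
          exact ⟨hbc.2.1, b, ih, hbc.1⟩) hc
        rw [hbc.2.2] at this
        exact Bool.noConfusion this
    · intro hx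
      rw [← h0, mem_clusterIn, connectedIn_iff] at hx
      obtain ⟨_, hx⟩ := hx
      have key : ConnectedIn ω₀ S 0 x ∧ ConnectedIn ω S 0 x := by
        induction hx with
        | refl =>
          exact ⟨mem_clusterIn.1 (h0 ▸ h0C), .refl h0' (h1 0 h0C)⟩
        | @tail b c _ hbc ih =>
          have hc := ih.1.tail hbc.1 hbc.2.1 hbc.2.2
          exact ⟨hc, ih.2.tail hbc.1 hbc.2.1 (h1 c (h0 ▸ mem_clusterIn.2 hc))⟩
      exact key.2

lemma measurableSet_siteSigma_clusterIn {S C : Finset (Site d)} (hC : C.Nonempty) :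
    MeasurableSet[siteSigma (neighborhoodIn S C : Set (Site d))]
      {ω : Config d | clusterIn S ω = C} := by
  by_cases h : ∃ ω₀ : Config d, clusterIn S ω₀ = C
  · obtain ⟨ω₀, h0⟩ := h
    rw [setOf_clusterIn_eq h0 hC]
    have hsub : C ⊆ S := h0 ▸ clusterIn_subset S ω₀
    refine MeasurableSet.inter ?_ ?_
    · refine MeasurableSet.biInter (Set.to_countable _) fun a ha =>
        measurableSet_siteSigma_state ?_ true
      simp only [neighborhoodIn, Finset.coe_filter, Set.mem_ofPred_eq]
      exact ⟨hsub ha, a, ha, by simp⟩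
    · exact MeasurableSet.biInter (Set.to_countable _) fun a ha => MeasurableSet.iInter fun _ =>
        measurableSet_siteSigma_state ha false
  · have : {ω : Config d | clusterIn S ω = C} = ∅ := by
      ext ω
      simp only [Set.mem_ofPred_eq, Set.mem_empty_iff_false, iff_false]
      exact fun h' => h ⟨ω, h'⟩
    rw [this]
    exact @MeasurableSet.empty _ (siteSigma _)

/-- After its last visit to the cluster `C` inside `S`, an open path avoids all of `neighborhoodIn S
C`, since an open site there would belong to `C`. The infinite cluster is thus covered by `C` and
finitely many clusters started at exits, one of which must be infinite. -/
lemma exists_infinite_exit {S B : Finset (Site d)}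
    (hB : ∀ x ∈ S, ∀ y, dist1 y x ≤ 1 → y ∉ S → y ∈ B) (h0 : (0 : Site d) ∈ S) {ω : Config d}
    (hω : ω ∈ infEvent Set.univ 0) :
    ∃ y ∈ B, (∃ c ∈ clusterIn S ω, dist1 y c ≤ 1) ∧
      ω ∈ infEvent ((neighborhoodIn S (clusterIn S ω) : Set (Site d))ᶜ) y := by
  set C := clusterIn S ω with hC
  have hω : {z | ConnectedIn ω Set.univ 0 z}.Infinite := hω
  have key : ∀ z, ConnectedIn ω Set.univ 0 z → z ∈ C ∨ ∃ y ∈ B, (∃ c ∈ C, dist1 y c ≤ 1) ∧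
      ConnectedIn ω ((neighborhoodIn S C : Set (Site d))ᶜ) y z := by
    intro z
    rw [connectedIn_iff]
    rintro ⟨⟨_, hω0⟩, hz⟩
    induction hz with
    | refl => exact Or.inl (mem_clusterIn.2 (.refl h0 hω0))
    | @tail z w _ hzw ih =>
      by_cases hw : w ∈ C
      · exact Or.inl hw
      right
      have hwK : w ∉ neighborhoodIn S C := by
        intro h
        simp only [neighborhoodIn, Finset.mem_filter] at h
        obtain ⟨hwS, c, hc, hwc⟩ := h
        exact hw (mem_clusterIn.2 ((mem_clusterIn.1 hc).tail hwc hwS hzw.2.2))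
      rcases ih with hz | ⟨y, hy, hyC, hyz⟩
      · have hzS : z ∈ S := (mem_clusterIn.1 hz).right_mem.1
        have hwS : w ∉ S := fun h => hwK (by
          simp only [neighborhoodIn, Finset.mem_filter]
          exact ⟨h, z, hz, hzw.1⟩)
        exact ⟨w, hB z hzS w hzw.1 hwS, ⟨z, hz, hzw.1⟩, .refl (by simpa using hwK) hzw.2.2⟩
      · exact ⟨y, hy, hyC, hyz.tail hzw.1 (by simpa using hwK) hzw.2.2⟩
  by_contra hno
  push Not at hno
  refine hω (((C.finite_toSet).union (Set.Finite.biUnion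
    (t := fun y => {z | (∃ c ∈ C, dist1 y c ≤ 1) ∧
      ConnectedIn ω ((neighborhoodIn S C : Set (Site d))ᶜ) y z})
    B.finite_toSet fun y hy => ?_)).subset fun z hz => ?_)
  · by_cases h : ∃ c ∈ C, dist1 y c ≤ 1
    · have := hno y hy h
      simp only [infEvent, Set.mem_ofPred_eq, Set.not_infinite] at this
      exact this.subset fun z hz => hz.2
    · exact Set.finite_empty.subset fun z hz => h hz.1
  · rcases key z hz with h | ⟨y, hy, h⟩
    · exact Or.inl h
    · exact Or.inr (Set.mem_biUnion hy h)

/-- If the expected number of exits from the finite set `S` is less than one, there is no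
percolation. -/
theorem theta_eq_zero_of_sum_exitEvent_lt_one (p : unitInterval) {S B : Finset (Site d)}
    (hB : ∀ x ∈ S, ∀ y, dist1 y x ≤ 1 → y ∉ S → y ∈ B) (h0 : (0 : Site d) ∈ S)
    (hlt : ∑ y ∈ B, (perc d p).real (exitEvent S y) < 1) : theta d p = 0 := by
  classical
  have hθ : 0 ≤ theta d p := measureReal_nonneg
  have hle : theta d p ≤ (∑ y ∈ B, (perc d p).real (exitEvent S y)) * theta d p := by
    set Cs : Site d → Finset (Finset (Site d)) := fun y =>
      S.powerset.filter fun C => ∃ c ∈ C, dist1 y c ≤ 1 with hCs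
    have hmeas : ∀ y, ∀ C ∈ Cs y, MeasurableSet {ω : Config d | clusterIn S ω = C} := by
      intro y C hC
      obtain ⟨_, c, hc, _⟩ := Finset.mem_filter.1 hC
      exact siteSigma_le _ _ (measurableSet_siteSigma_clusterIn ⟨c, hc⟩)
    have hcover : {ω : Config d | (cluster ω 0).Infinite} ⊆ ⋃ y ∈ B, ⋃ C ∈ Cs y,
        {ω | clusterIn S ω = C} ∩ infEvent ((neighborhoodIn S C : Set (Site d))ᶜ) y := by
      intro ω hω
      obtain ⟨y, hy, hyC, hinf⟩ := exists_infinite_exit hB h0 hω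
      refine Set.mem_biUnion hy (Set.mem_biUnion (x := clusterIn S ω) ?_ ⟨rfl, hinf⟩)
      exact Finset.mem_filter.2 ⟨Finset.mem_powerset.2 (clusterIn_subset S ω), hyC⟩
    rw [Finset.sum_mul]
    refine (measureReal_mono hcover (measure_ne_top _ _)).trans ((measureReal_biUnion_finset_le _ _).trans
      (Finset.sum_le_sum fun y _ => ?_))
    -- The value of the cluster depends only on `neighborhoodIn S C` and the escape only on its
    -- complement, so the two are independent.
    have hterm : ∀ C ∈ Cs y, (perc d p).real ({ω | clusterIn S ω = C} ∩
        infEvent ((neighborhoodIn S C : Set (Site d))ᶜ) y)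
        ≤ (perc d p).real {ω | clusterIn S ω = C} * theta d p := by
      intro C hC
      obtain ⟨_, c, hc, _⟩ := Finset.mem_filter.1 hC
      rw [perc_real_inter_of_disjoint p disjoint_compl_right
        (measurableSet_siteSigma_clusterIn ⟨c, hc⟩) (measurableSet_siteSigma_infEvent _ y)]
      refine mul_le_mul_of_nonneg_left ?_ measureReal_nonneg
      refine (measureReal_mono fun ω hω => ?_).trans (perc_real_infEvent_le_theta p y)
      have hω : {z | ConnectedIn ω _ y z}.Infinite := hω
      exact hω.mono fun z hz => ConnectedIn.mono hz fun a _ ha => ⟨trivial, ha⟩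
    refine (measureReal_biUnion_finset_le _ _).trans ((Finset.sum_le_sum hterm).trans ?_)
    rw [← Finset.sum_mul]
    refine mul_le_mul_of_nonneg_right ?_ hθ
    -- Distinct values of the cluster give disjoint events; those touching `y` add up to the exit
    -- event at `y`.
    rw [← measureReal_biUnion_finset ?_ (hmeas y)]
    · refine measureReal_mono fun ω hω => ?_
      simp only [Set.mem_iUnion, Set.mem_ofPred_eq, exists_prop] at hω
      obtain ⟨C, hC, rfl⟩ := hω
      obtain ⟨hCS, c, hc, hyc⟩ := Finset.mem_filter.1 hC
      exact ⟨c, Finset.mem_powerset.1 hCS hc, hyc, mem_clusterIn.1 hc⟩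
    · intro C _ C' _ hne
      refine Set.disjoint_left.2 fun ω h h' => hne ?_
      exact (show clusterIn S ω = C from h).symm.trans h'
  nlinarith

lemma theta_one (hd : 0 < d) : theta d 1 = 1 := by
  have hperc : perc d 1 = Measure.dirac (fun _ => true) := by
    simp only [perc, bernoulliMeasure_one, Measure.infinitePi_dirac]
  have hmem : (fun _ => true : Config d) ∈ {ω : Config d | (cluster ω 0).Infinite} := by
    set e : ℕ → Site d := fun k => Pi.single ⟨0, hd⟩ (k : ℤ) with he
    refine Set.Infinite.mono (s := Set.range e) ?_ (Set.infinite_range_of_injective ?_)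
    · rintro _ ⟨k, rfl⟩
      refine ⟨k, e, by simp [he], rfl, fun i _ => ?_, fun _ _ => ⟨trivial, rfl⟩⟩
      have : ∀ j, e (i + 1) j - e i j = if j = ⟨0, hd⟩ then 1 else 0 := by
        intro j
        by_cases h : j = ⟨0, hd⟩
        · subst h; simp [he]
        · simp [he, h]
      simp only [dist1, this]
      rw [Finset.sum_eq_single ⟨0, hd⟩] <;> simp +contextual
    · intro k l h
      have := congrFun h ⟨0, hd⟩
      simpa [he] using this
  rw [theta, hperc, measureReal_def, Measure.dirac_apply_of_mem hmem, ENNReal.toReal_one]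

/-- At the critical point the expected number of exits from a finite set is at least one. -/
theorem one_le_sum_exitEvent (hd : 0 < d) {S B : Finset (Site d)}
    (hB : ∀ x ∈ S, ∀ y, dist1 y x ≤ 1 → y ∉ S → y ∈ B) (h0 : (0 : Site d) ∈ S) :
    1 ≤ ∑ y ∈ B, (perc d (criticalProb d)).real (exitEvent S y) := by
  by_contra! hlt
  have hcont : Continuous fun p => ∑ y ∈ B, (perc d p).real (exitEvent S y) :=
    continuous_finsetSum _ fun y _ => continuous_perc_real (determinedBy_exitEvent S y)
  rcases eq_or_lt_of_le (le_top : criticalProb d ≤ ⊤) with htop | htop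
  · have h1 : criticalProb d = 1 := htop
    have := theta_eq_zero_of_sum_exitEvent_lt_one _ hB h0 hlt
    rw [h1, theta_one hd] at this
    exact one_ne_zero this
  -- The strict inequality survives slightly above the critical point, where θ would then vanish,
  -- contradicting the supremum.
  · have hev := (hcont.tendsto (criticalProb d)).eventually_lt_const hlt
    have hne : (nhdsWithin (criticalProb d) (Set.Ioi (criticalProb d))).NeBot :=
      nhdsGT_neBot_of_exists_gt ⟨⊤, htop⟩
    obtain ⟨p, hp, hpgt⟩ := 
      ((hev.filter_mono nhdsWithin_le_nhds).and (self_mem_nhdsWithin (s := Set.Ioi (criticalProb d)))).exists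
    have hmem : p ∈ {p | theta d p = 0} := theta_eq_zero_of_sum_exitEvent_lt_one p hB h0 hp
    exact absurd (le_sSup hmem) (not_le.2 hpgt)

end Criticality

/-! ### Good paths and the chaining of connections. -/

section Connections

variable {d : ℕ}

lemma perc_real_allOpen (p : unitInterval) (F : Finset (Site d)) :
    (perc d p).real {ω | ∀ a ∈ F, ω a = true} = (p : ℝ) ^ F.card := by
  have hset : {ω : Config d | ∀ a ∈ F, ω a = true} = Set.pi F fun _ => {true} := by
    ext ω; simp
  have h := Measure.infinitePi_pi (fun _ : Site d => bernoulliMeasure true false p) (s := F)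
    (t := fun _ => {true}) fun _ _ => MeasurableSet.singleton _
  rw [hset, measureReal_def, perc, h, ENNReal.toReal_prod]
  simp only [← measureReal_def]
  rw [bernoulliMeasure_real_apply_of_mem_of_notMem p (MeasurableSet.singleton _) rfl (by simp),
    Finset.prod_const]

/-- The lattice box `[-n, n]^d` as a finite set. -/
noncomputable def boxFinset (d n : ℕ) : Finset (Site d) := Fintype.piFinset fun _ => Finset.Icc (-(n : ℤ)) n

lemma mem_boxFinset {n : ℕ} {x : Site d} : x ∈ boxFinset d n ↔ ∀ i, |x i| ≤ n := by
  simp [boxFinset, abs_le]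

lemma card_boxFinset (d n : ℕ) : (boxFinset d n).card = (2 * n + 1) ^ d := by
  rw [boxFinset, Fintype.card_piFinset_const, Int.card_Icc]
  congr 1
  omega

lemma zero_mem_boxFinset (d n : ℕ) : (0 : Site d) ∈ boxFinset d n := by
  simp [mem_boxFinset]

lemma coe_boxFinset (d n : ℕ) : (boxFinset d n : Set (Site d)) = box d n := by
  ext x
  simp only [Finset.mem_coe, mem_boxFinset, box, Set.mem_ofPred_eq]
  exact forall_congr' fun i => by exact_mod_cast Iff.rfl

lemma perc_real_mul_le_trans (p : unitInterval) (S : Finset (Site d)) (x y z : Site d) :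
    (perc d p).real (connEvent S x y) * (perc d p).real (connEvent S y z)
      ≤ (perc d p).real (connEvent S x z) :=
  (harris p (determinedBy_connEvent subset_rfl x y) (determinedBy_connEvent subset_rfl y z)
    (increasing_connEvent _ _ _) (increasing_connEvent _ _ _)).trans
    (measureReal_mono fun _ h => ConnectedIn.trans h.1 h.2)

/-- Moving one coordinate one unit towards `v` lowers the distance and stays in the order interval
spanned by the endpoints. -/
lemma connectedIn_of_hull {ω : Config d} {S : Set (Site d)} {v : Site d} (N : ℕ) :
    ∀ u : Site d, dist1 u v ≤ N → (∀ a ∈ Set.Icc (u ⊓ v) (u ⊔ v), a ∈ S ∧ ω a = true) →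
      ConnectedIn ω S u v := by
  induction N with
  | zero =>
    intro u hu h
    have : u = v := by
      ext i
      have := (abs_sub_le_dist1 u v i).trans hu
      simpa [sub_eq_zero] using this
    subst this
    have := h u (by simp)
    exact .refl this.1 this.2
  | succ N ih =>
    intro u hu h
    by_cases huv : u = v
    · subst huv
      have := h u (by simp)
      exact .refl this.1 this.2
    obtain ⟨i, hi⟩ := Function.ne_iff.1 huv
    set ε : ℤ := if u i < v i then 1 else -1 with hε
    set u' : Site d := Function.update u i (u i + ε) with hu'
    have hu'i : u' i = u i + ε := by simp [hu']
    have hu'j : ∀ j, j ≠ i → u' j = u j := fun j hj => by simp [hu', hj]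
    have hdist : dist1 u' v < dist1 u v := by
      refine Finset.sum_lt_sum (fun j _ => ?_) ⟨i, Finset.mem_univ i, ?_⟩
      · by_cases hj : j = i
        · subst hj
          rw [hu'i, hε]
          split_ifs <;> simp only [abs_le', le_abs] <;> omega
        · rw [hu'j j hj]
      · rw [hu'i, hε]
        split_ifs <;> simp only [abs_lt, lt_abs] <;> omega
    have hstep : dist1 u' u ≤ 1 := by
      rw [dist1, Finset.sum_eq_single i]
      · rw [hu'i, hε]; split_ifs <;> simp
      · intro j _ hj; simp [hu'j j hj]
      · simp
    have hsub : Set.Icc (u' ⊓ v) (u' ⊔ v) ⊆ Set.Icc (u ⊓ v) (u ⊔ v) := by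
      refine Set.Icc_subset_Icc (fun j => ?_) fun j => ?_
      all_goals
        by_cases hj : j = i
        · subst hj
          simp only [Pi.inf_apply, Pi.sup_apply, hu'i, hε]
          split_ifs <;> omega
        · simp [hu'j j hj]
    have hmem := h u ⟨inf_le_left, le_sup_left⟩
    have hrest := ih u' (by omega) fun a ha => h a (hsub ha)
    exact ((ConnectedIn.refl hmem.1 hmem.2).tail hstep hrest.left_mem.1 hrest.left_mem.2).trans
      hrest

lemma pow_le_perc_real_connEvent (p : unitInterval) {N K : ℕ} {u v : Site d}
    (hu : u ∈ boxFinset d N) (hv : v ∈ boxFinset d N) (huv : ∀ i, |v i - u i| ≤ K) :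
    (p : ℝ) ^ ((K + 1) ^ d) ≤ (perc d p).real (connEvent (boxFinset d N) u v) := by
  set F : Finset (Site d) := Finset.Icc (u ⊓ v) (u ⊔ v) with hF
  have hcard : F.card ≤ (K + 1) ^ d := by
    rw [hF, Pi.card_Icc]
    refine (Finset.prod_le_pow_card _ _ (K + 1) fun i _ => ?_).trans (by simp)
    rw [Int.card_Icc]
    have := abs_le.1 (huv i)
    simp only [Pi.inf_apply, Pi.sup_apply]
    omega
  refine (pow_le_pow_of_le_one p.2.1 p.2.2 hcard).trans ?_
  rw [← perc_real_allOpen]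
  refine measureReal_mono fun ω hω => connectedIn_of_hull (dist1 u v).toNat u
    (Int.self_le_toNat _) fun a ha => ⟨?_, hω a (Finset.mem_Icc.2 ha)⟩
  rw [mem_boxFinset] at hu hv
  refine mem_boxFinset.2 fun i => ?_
  have h1 := ha.1 i
  have h2 := ha.2 i
  have h3 := abs_le.1 (hu i)
  have h4 := abs_le.1 (hv i)
  simp only [Pi.inf_apply, Pi.sup_apply] at h1 h2
  rw [abs_le]
  omega

/-- The signed coordinate permutation followed by a translation. -/
def signedPerm (y s : Site d) (hs : ∀ i, s i = 1 ∨ s i = -1) (τ : Equiv.Perm (Fin d)) :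
    Site d ≃ Site d where
  toFun z i := y i + s i * z (τ i)
  invFun w j := s (τ.symm j) * (w (τ.symm j) - y (τ.symm j))
  left_inv z := by
    ext j
    rcases hs (τ.symm j) with h | h <;> simp [h]
  right_inv w := by
    ext i
    rcases hs i with h | h <;> simp [h]

lemma dist1_signedPerm (y s : Site d) (hs : ∀ i, s i = 1 ∨ s i = -1) (τ : Equiv.Perm (Fin d))
    (a b : Site d) : dist1 (signedPerm y s hs τ a) (signedPerm y s hs τ b) = dist1 a b := by
  simp only [dist1]
  rw [← Equiv.sum_comp τ fun i => |a i - b i|]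
  refine Finset.sum_congr rfl fun i _ => ?_
  have : signedPerm y s hs τ a i - signedPerm y s hs τ b i = s i * (a (τ i) - b (τ i)) := by
    simp only [signedPerm, Equiv.coe_fn_mk]; ring
  rw [this]
  rcases hs i with h | h <;> simp [h, abs_sub_comm]

lemma perc_real_connEvent_le_signedPerm (p : unitInterval) {n N : ℕ} (y s : Site d)
    (hs : ∀ i, s i = 1 ∨ s i = -1) (τ : Equiv.Perm (Fin d)) (hy : ∀ i, |y i| + n ≤ N)
    {z w : Site d} (hw : ∀ i, w i = y i + s i * z (τ i)) :
    (perc d p).real (connEvent (boxFinset d n) 0 z)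
      ≤ (perc d p).real (connEvent (boxFinset d N) y w) := by
  have h := perc_real_connEvent_le_map p (signedPerm y s hs τ)
    (fun a b h => (dist1_signedPerm y s hs τ a b).trans_le h)
    (S := (boxFinset d n : Set (Site d))) (S' := (boxFinset d N : Set (Site d)))
    (fun a ha => ?_) 0 z
  · have h0 : signedPerm y s hs τ 0 = y := by ext i; simp [signedPerm]
    have hz : signedPerm y s hs τ z = w := by ext i; simp [signedPerm, hw i]
    rwa [h0, hz] at h
  · refine mem_boxFinset.2 fun i => ?_
    have h1 := mem_boxFinset.1 ha (τ i)
    have h2 := abs_add_le (y i) (s i * a (τ i))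
    have h3 : |s i * a (τ i)| = |a (τ i)| := by rcases hs i with h | h <;> simp [h]
    have := hy i
    simp only [signedPerm, Equiv.coe_fn_mk]
    linarith

lemma criticalProb_pos (hd : 0 < d) : 0 < (criticalProb d : ℝ) := by
  by_contra hp
  have h1 := one_le_sum_exitEvent hd (S := {0}) (B := boxFinset d 1) (fun x hx y hy _ => by
    rw [Finset.mem_singleton.1 hx] at hy
    refine mem_boxFinset.2 fun i => ?_
    simpa using (abs_sub_le_dist1 y 0 i).trans hy) (Finset.mem_singleton_self _)
  rw [Finset.sum_eq_zero] at h1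
  · linarith
  · intro y _
    refine le_antisymm ?_ measureReal_nonneg
    have h2 := perc_real_allOpen (criticalProb d) ({0} : Finset (Site d))
    rw [Finset.card_singleton, pow_one] at h2
    refine le_trans (measureReal_mono ?_) (h2.le.trans (not_lt.1 hp))
    rintro ω ⟨x, _, _, hx⟩ a ha
    rw [Finset.mem_singleton.1 ha]
    exact hx.left_mem.2

/-- The exit event ignores the state of `y`; opening `y` costs a factor `p` by Harris' inequality.
-/
lemma exitEvent_mul_le (p : unitInterval) {S K : Finset (Site d)} (hSK : S ⊆ K) {y : Site d}
    (hy : y ∈ K) :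
    (perc d p).real (exitEvent S y) * p ≤ (perc d p).real (connEvent K 0 y) := by
  have h2 := perc_real_allOpen p ({y} : Finset (Site d))
  rw [Finset.card_singleton, pow_one] at h2
  rw [← h2]
  have hdet : DeterminedBy {ω : Config d | ∀ a ∈ ({y} : Finset (Site d)), ω a = true} K :=
    fun ω ω' h hω a ha => by
      rw [← h a (Finset.mem_singleton.1 ha ▸ hy)]; exact hω a ha
  refine (harris p (fun ω ω' h => determinedBy_exitEvent S y ω ω' fun a ha => h a (hSK ha)) hdet
    (increasing_exitEvent S y) fun ω ω' h hω a ha => h a (hω a ha)).trans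
    (measureReal_mono ?_)
  rintro ω ⟨⟨x, hx, hyx, hc⟩, hω⟩
  have hc' : ConnectedIn ω K 0 x := hc.mono fun a ha hωa => ⟨hSK ha, hωa⟩
  exact hc'.tail hyx hy (hω y (Finset.mem_singleton_self y))

/-- At criticality there is a lattice path from the origin to the boundary of `[-n, n]^d` all of
whose sites are connected to the origin inside the box with probability of order `n^{-d}`. -/
theorem exists_path_connEvent_ge (hd : 0 < d) {n : ℕ} (hn : 1 ≤ n) :
    ∃ (T : ℕ) (γ : ℕ → Site d) (k : Fin d), γ 0 = 0 ∧ |γ T k| = n ∧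
      (∀ t < T, dist1 (γ (t + 1)) (γ t) ≤ 1) ∧ ∀ t ≤ T, γ t ∈ boxFinset d n ∧
        (criticalProb d : ℝ) / (2 * 3 ^ d) / (n : ℝ) ^ d ≤
          (perc d (criticalProb d)).real (connEvent (boxFinset d n) 0 (γ t)) := by
  classical
  set p := criticalProb d with hp
  have hp0 : 0 < (p : ℝ) := criticalProb_pos hd
  have hn' : (1 : ℝ) ≤ n := by exact_mod_cast hn
  set δ : ℝ := (p : ℝ) / (2 * 3 ^ d) / (n : ℝ) ^ d with hδ
  -- Goodness is encoded as a deterministic configuration, so that the cluster lemmas apply to it.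
  set good : Config d := fun y =>
    decide (δ ≤ (perc d p).real (connEvent (boxFinset d n) 0 y)) with hgood
  have hδp : δ ≤ p := by
    rw [hδ, div_div]
    refine div_le_self hp0.le (one_le_mul_of_one_le_of_one_le ?_ (one_le_pow₀ hn'))
    have : (1 : ℝ) ≤ 3 ^ d := one_le_pow₀ (by norm_num)
    linarith
  have hgood0 : good 0 = true := by
    simp only [hgood, decide_eq_true_eq]
    refine hδp.trans ?_
    have h := perc_real_allOpen p ({0} : Finset (Site d))
    rw [Finset.card_singleton, pow_one] at h
    rw [← h]
    exact measureReal_mono fun ω hω =>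
      ConnectedIn.refl (zero_mem_boxFinset d n) (hω 0 (Finset.mem_singleton_self 0))
  suffices h : ∃ y, ConnectedIn good (boxFinset d n) 0 y ∧ ∃ k, |y k| = n by
    obtain ⟨y, ⟨T, γ, h0, hT, h1, h2⟩, k, hk⟩ := h
    refine ⟨T, γ, k, h0, hT ▸ hk, h1, fun t ht => ⟨(h2 t ht).1, ?_⟩⟩
    simpa [hgood] using (h2 t ht).2
  by_contra! hno
  set S := clusterIn (boxFinset d n) good with hS
  have hSbox : S ⊆ boxFinset d n := clusterIn_subset _ _
  have hlt := one_le_sum_exitEvent hd (S := S) (B := boxFinset d n \ S) (fun x hx y hyx hyS => by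
    refine Finset.mem_sdiff.2 ⟨mem_boxFinset.2 fun i => ?_, hyS⟩
    have h1 := hno x (mem_clusterIn.1 hx) i
    have h2 := mem_boxFinset.1 (hSbox hx) i
    have h3 := (abs_sub_le_dist1 y x i).trans hyx
    have h4 := abs_sub_abs_le_abs_sub (y i) (x i)
    have h5 := lt_of_le_of_ne h2 h1
    omega) (mem_clusterIn.2 (.refl (zero_mem_boxFinset d n) hgood0))
  -- A site adjacent to the good cluster but outside it is bad; a site not adjacent has an empty
  -- exit event.
  have hterm : ∀ y ∈ boxFinset d n \ S, (perc d p).real (exitEvent S y) ≤ δ / p := by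
    intro y hy
    obtain ⟨hyb, hyS⟩ := Finset.mem_sdiff.1 hy
    by_cases hx : ∃ x ∈ S, dist1 y x ≤ 1
    · obtain ⟨x, hx, hyx⟩ := hx
      rw [le_div_iff₀ hp0]
      refine (exitEvent_mul_le p hSbox hyb).trans ?_
      by_contra! hlt
      refine hyS (mem_clusterIn.2 ((mem_clusterIn.1 hx).tail hyx hyb ?_))
      simpa [hgood] using hlt.le
    · have : exitEvent S y = ∅ := by
        ext ω
        simp only [exitEvent, Set.mem_ofPred_eq, Set.mem_empty_iff_false, iff_false]
        rintro ⟨x, h1, h2, _⟩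
        exact hx ⟨x, h1, h2⟩
      rw [this, measureReal_empty]
      positivity
  have h1 := hlt.trans (Finset.sum_le_card_nsmul _ _ _ hterm)
  have h2 : ((boxFinset d n \ S).card : ℝ) ≤ (3 * n) ^ d := by
    have : (boxFinset d n \ S).card ≤ (3 * n) ^ d := by
      refine (Finset.card_le_card Finset.sdiff_subset).trans ?_
      rw [card_boxFinset]
      exact Nat.pow_le_pow_left (by omega) d
    exact_mod_cast this
  have h3 : (3 * (n : ℝ)) ^ d * (δ / p) = 1 / 2 := by
    rw [hδ, mul_pow]
    have : (0 : ℝ) < n := by linarith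
    field_simp
  rw [nsmul_eq_mul] at h1
  have h4 : ((boxFinset d n \ S).card : ℝ) * (δ / p) ≤ (3 * (n : ℝ)) ^ d * (δ / p) :=
    mul_le_mul_of_nonneg_right h2 (by positivity)
  linarith

/-- The lower bound for point-to-point connections in boxes at criticality. -/
theorem exists_const_connEvent_boxFinset_ge (hd : 0 < d) :
    ∃ c : ℝ, 0 < c ∧ ∀ n : ℕ, 1 ≤ n → ∀ x ∈ boxFinset d n, c / (n : ℝ) ^ (d ^ 2) ≤
      (perc d (criticalProb d)).real (connEvent (boxFinset d (4 * n)) 0 x) := by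
  have hp0 := criticalProb_pos hd
  -- The three factors pay for an open origin, for the `d` chained connections, and for opening the
  -- order interval that bridges the final error.
  refine ⟨(criticalProb d : ℝ) * ((criticalProb d : ℝ) / (2 * 3 ^ d)) ^ d *
    (criticalProb d : ℝ) ^ ((d + 1) ^ d), by positivity, fun n hn x hx => ?_⟩
  obtain ⟨T, γ, k, h0, hT, hstep, hγ⟩ := exists_path_connEvent_ge hd hn
  set p := criticalProb d with hp
  set δ : ℝ := (p : ℝ) / (2 * 3 ^ d) / (n : ℝ) ^ d with hδ
  have hδ0 : 0 ≤ δ := by positivity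
  obtain ⟨y, hy0, hyb, hys, hyd⟩ := exists_signed_sum γ k h0 hT
    (fun t ht => mem_boxFinset.1 (hγ t ht).1)
    (fun t ht i => (abs_sub_le_dist1 _ _ i).trans (hstep t ht)) x (mem_boxFinset.1 hx)
  have hchain : ∀ m ≤ d, p * δ ^ m ≤
      (perc d p).real (connEvent (boxFinset d (4 * n)) 0 (y m)) := by
    intro m
    induction m with
    | zero =>
      intro _
      have h := perc_real_allOpen p ({0} : Finset (Site d))
      rw [Finset.card_singleton, pow_one] at h
      rw [hy0, pow_zero, mul_one, ← h]
      exact measureReal_mono fun ω hω =>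
        ConnectedIn.refl (zero_mem_boxFinset d _) (hω 0 (Finset.mem_singleton_self 0))
    | succ m ih =>
      intro hm
      obtain ⟨t, ht, τ, s, hs, hys⟩ := hys m hm
      -- The box of radius `n` is moved to `y m`, which lies within `3 * n` of the origin; this is
      -- where `4 * n` comes from.
      have h1 := perc_real_connEvent_le_signedPerm p (n := n) (N := 4 * n) (y m) s hs τ
        (fun i => by have := hyb m i; push_cast; linarith) hys
      have h2 := (hγ t ht).2.trans h1
      rw [pow_succ, ← mul_assoc]
      exact (mul_le_mul (ih (by omega)) h2 hδ0 measureReal_nonneg).trans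
        (perc_real_mul_le_trans p _ _ _ _)
  have hlast := pow_le_perc_real_connEvent p (N := 4 * n) (K := d) (u := y d) (v := x)
    (mem_boxFinset.2 fun i => by have := hyb d i; push_cast; linarith)
    (mem_boxFinset.2 fun i => by have := mem_boxFinset.1 hx i; push_cast; linarith) hyd
  refine le_trans (le_of_eq ?_) ((mul_le_mul (hchain d le_rfl) hlast (by positivity)
    measureReal_nonneg).trans (perc_real_mul_le_trans p _ _ _ _))
  rw [hδ, div_pow _ ((n : ℝ) ^ d), ← pow_mul, sq]
  ring

lemma exists_nat_norm_eq (x : Site d) : ∃ n : ℕ, ‖x‖ = n ∧ x ∈ boxFinset d n := by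
  have hle : ∀ i, (x i).natAbs ≤ Finset.univ.sup fun i => (x i).natAbs := fun i =>
    Finset.le_sup (f := fun i => (x i).natAbs) (Finset.mem_univ i)
  have hnorm : ∀ i, ‖x i‖ = ((x i).natAbs : ℝ) := fun i => by
    rw [Int.norm_eq_abs, Nat.cast_natAbs, Int.cast_abs]
  refine ⟨Finset.univ.sup fun i => (x i).natAbs, le_antisymm ?_ ?_, ?_⟩
  · refine (pi_norm_le_iff_of_nonneg (Nat.cast_nonneg _)).2 fun i => ?_
    rw [hnorm]
    exact_mod_cast hle i
  · rcases Finset.univ.eq_empty_or_nonempty (α := Fin d) with h | h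
    · simp [h]
    · obtain ⟨i, _, hi⟩ := Finset.exists_mem_eq_sup _ h fun i => (x i).natAbs
      rw [hi, ← hnorm]
      exact norm_le_pi_norm x i
  · refine mem_boxFinset.2 fun i => ?_
    rw [Int.abs_eq_natAbs]
    exact_mod_cast hle i

end Connections

end SitePercolation

theorem theorem1 (d : ℕ) (hd : 2 ≤ d) :
    ∃ c : ℝ, 0 < c ∧
      (∀ x : SitePercolation.Site d, x ≠ 0 →
        c / ‖x‖ ^ (d ^ 2) ≤
          (SitePercolation.perc d (SitePercolation.criticalProb d)).real
            (SitePercolation.connEvent (SitePercolation.box d (4 * ‖x‖)) 0 x)) ∧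
      (∀ n : ℕ, 1 ≤ n → ∀ x ∈ SitePercolation.box d n,
        c / (n : ℝ) ^ (d ^ 2) ≤
          (SitePercolation.perc d (SitePercolation.criticalProb d)).real
            (SitePercolation.connEvent (SitePercolation.box d (4 * n)) 0 x)) := by
  obtain ⟨c, hc, key⟩ :=
    SitePercolation.exists_const_connEvent_boxFinset_ge (show 0 < d by omega)
  have hbox : ∀ n : ℕ, (SitePercolation.boxFinset d (4 * n) : Set (SitePercolation.Site d))
      = SitePercolation.box d (4 * n) := fun n => by
    rw [SitePercolation.coe_boxFinset]; push_cast; rfl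
  refine ⟨c, hc, fun x hx => ?_, fun n hn x hx => ?_⟩
  · obtain ⟨n, hn, hxn⟩ := SitePercolation.exists_nat_norm_eq x
    have hn1 : 1 ≤ n := by
      have : (0 : ℝ) < n := hn ▸ norm_pos_iff.2 hx
      exact_mod_cast this
    rw [hn, ← hbox]
    exact key n hn1 x hxn
  · rw [← hbox]
    refine key n hn x ?_
    rwa [← Finset.mem_coe, SitePercolation.coe_boxFinset]
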